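/- Let $\omega,\gamma,\kappa_1,\kappa_2>0$ and let $\sigma_x,\sigma_y,\sigma_z$ be the Pauli matrices. Controls $u_1,u_2$ are real functions in $L^1(0,T)$, trajectories are absolutely continuous, and equations hold for almost every $t\in[0,T]$. A qubit with two coherent controls is completely controllable in the interior of the Bloch ball and on the set of non-pure density matrices, already without incoherent control: (i) Consider the Bloch system on $\mathbb R^3$ $$\dot{\mathbf r}=\omega f_0(\mathbf r)+2\kappa_1u_1(t)\,f_x(\mathbf r)+2\kappa_2u_2(t)\,f_y(\mathbf r),$$ where, for $\mathbf r=(x,y,z)$, $$f_0(\mathbf r)=\Bigl(-y-\tfrac{\gamma}{2\omega}x,\ x-\tfrac{\gamma}{2\omega}y,\ \tfrac{\gamma}{\omega}(1-z)\Bigr),\qquad f_x(\mathbf r)=(0,-z,y),\qquad f_y(\mathbf r)=(z,0,-x).$$ For any two interior points $\mathbf r^0,\mathbf r^1$ of the Bloch ball $\{|\mathbf r|\le1\}$ there are a finite time $T\ge0$, controls $u_1,u_2\in L^1(0,T)$ and a trajectory with $\mathbf r(0)=\mathbf r^0$ and $\mathbf r(T)=\mathbf r^1$. (ii) Consider the master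 equation on $2\times2$ complex matrices $$\dot\rho=-i\bigl[\omega\sigma_z+\kappa_1u_1(t)\sigma_x+\kappa_2u_2(t)\sigma_y,\ \rho\bigr]+\gamma(n(t)+1)\Bigl(\sigma^-\rho\sigma^+-\tfrac12\{\sigma^+\sigma^-,\rho\}\Bigr)+\gamma n(t)\Bigl(\sigma^+\rho\sigma^--\tfrac12\{\sigma^-\sigma^+,\rho\}\Bigr)$$ with incoherent control $n\equiv0$, where $\sigma^+=\begin{pmatrix}0&0\\1&0\end{pmatrix}$ and $\sigma^-=\begin{pmatrix}0&1\\0&0\end{pmatrix}$. For any two density matrices $\rho^0,\rho^1$ ($\rho\ge0$, $\operatorname{Tr}\rho=1$) that are not pure ($\rho^2\ne\rho$) there are a finite time $T\ge0$, controls $u_1,u_2\in L^1(0,T)$ and a trajectory with $\rho(0)=\rho^0$ and $\rho(T)=\rho^1$. (The two normalizations of the frequency differ: under $\rho=\frac12(I+x\sigma_x+y\sigma_y+z\sigma_z)$ the master equation in (ii) becomes the system in (i) with rotation rate $2\omega$ around the $z$ axis, while the relaxation terms and the control terms agree.) -/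

import Mathlib

open MeasureTheory Matrix
open scoped ComplexOrder

noncomputable section

namespace QubitControl

/-! ### Bloch vectors -/

/-- The Bloch ball, as the closed Euclidean unit ball of `ℝ³`; coordinates `0, 1, 2` are
`x, y, z`. -/
def blochBall : Set (EuclideanSpace ℝ (Fin 3)) := Metric.closedBall 0 1

/-- The uncontrolled vector field `f₀`: rotation around the `z` axis, plus `γ / ω` times the
relaxation towards `(0, 0, 1)`. -/
def f₀ (ω γ : ℝ) (r : EuclideanSpace ℝ (Fin 3)) : EuclideanSpace ℝ (Fin 3) :=
  !₂[-(r 1) - γ / ω * (1 / 2 * r 0), r 0 - γ / ω * (1 / 2 * r 1), -(γ / ω * r 2) + γ / ω]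

/-- The generator of rotations around the `x` axis. -/
def fx (r : EuclideanSpace ℝ (Fin 3)) : EuclideanSpace ℝ (Fin 3) := !₂[0, -(r 2), r 1]

/-- The generator of rotations around the `y` axis. -/
def fy (r : EuclideanSpace ℝ (Fin 3)) : EuclideanSpace ℝ (Fin 3) := !₂[r 2, 0, -(r 0)]

/-- The right-hand side of the Bloch system with two coherent controls (values `u₁`, `u₂`) and
without incoherent control. -/
def blochField (ω γ κ₁ κ₂ u₁ u₂ : ℝ) (r : EuclideanSpace ℝ (Fin 3)) :
    EuclideanSpace ℝ (Fin 3) :=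
  ω • f₀ ω γ r + (2 * κ₁ * u₁) • fx r + (2 * κ₂ * u₂) • fy r

/-- `r` is a (Carathéodory) trajectory on `[0, T]` of the Bloch system for the controls
`u₁, u₂`, in the equivalent integral form.  The integrand is integrable as soon as `u₁`, `u₂` are
integrable on `[0, T]` and `r` is continuous there. -/
def IsBlochTrajectory (ω γ κ₁ κ₂ T : ℝ) (u₁ u₂ : ℝ → ℝ) (r : ℝ → EuclideanSpace ℝ (Fin 3)) :
    Prop :=
  ContinuousOn r (Set.Icc 0 T) ∧
    ∀ t ∈ Set.Icc 0 T, r t = r 0 + ∫ s in (0 : ℝ)..t, blochField ω γ κ₁ κ₂ (u₁ s) (u₂ s) (r s)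

/-- The points exactly reachable from `r₀` in finite time by integrable coherent controls. -/
def blochReachableSet (ω γ κ₁ κ₂ : ℝ) (r₀ : EuclideanSpace ℝ (Fin 3)) :
    Set (EuclideanSpace ℝ (Fin 3)) :=
  {r₁ | ∃ T : ℝ, 0 ≤ T ∧ ∃ u₁ u₂ : ℝ → ℝ,
    IntervalIntegrable u₁ volume 0 T ∧ IntervalIntegrable u₂ volume 0 T ∧
    ∃ r : ℝ → EuclideanSpace ℝ (Fin 3),
      IsBlochTrajectory ω γ κ₁ κ₂ T u₁ u₂ r ∧ r 0 = r₀ ∧ r T = r₁}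

/-! ### Density matrices -/

/-- The Pauli matrix `σ_x`. -/
def σx : Matrix (Fin 2) (Fin 2) ℂ := !![0, 1; 1, 0]

/-- The Pauli matrix `σ_y`. -/
def σy : Matrix (Fin 2) (Fin 2) ℂ := !![0, -Complex.I; Complex.I, 0]

/-- The Pauli matrix `σ_z`. -/
def σz : Matrix (Fin 2) (Fin 2) ℂ := !![1, 0; 0, -1]

/-- The raising matrix `|1⟩⟨0|`; the ground state `|0⟩` is the first basis vector. -/
def σp : Matrix (Fin 2) (Fin 2) ℂ := !![0, 0; 1, 0]

/-- The lowering matrix `|0⟩⟨1|`. -/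
def σm : Matrix (Fin 2) (Fin 2) ℂ := !![0, 1; 0, 0]

/-- Density matrices of a qubit. -/
def IsDensityMatrix (ρ : Matrix (Fin 2) (Fin 2) ℂ) : Prop := ρ.PosSemidef ∧ ρ.trace = 1

/-- Pure states: the density matrices that are (necessarily rank one) projections. -/
def IsPureState (ρ : Matrix (Fin 2) (Fin 2) ℂ) : Prop := IsDensityMatrix ρ ∧ ρ * ρ = ρ

/-- The Hamiltonian with two coherent controls. -/
def hamiltonian (ω κ₁ κ₂ u₁ u₂ : ℝ) : Matrix (Fin 2) (Fin 2) ℂ :=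
  (ω : ℂ) • σz + ((κ₁ * u₁ : ℝ) : ℂ) • σx + ((κ₂ * u₂ : ℝ) : ℂ) • σy

/-- The dissipator `L ρ Lᴴ - ½ {Lᴴ L, ρ}`. -/
def dissipator (L ρ : Matrix (Fin 2) (Fin 2) ℂ) : Matrix (Fin 2) (Fin 2) ℂ :=
  L * ρ * Lᴴ - (1 / 2 : ℂ) • (Lᴴ * L * ρ + ρ * (Lᴴ * L))

/-- The right-hand side of the master equation with coherent controls `u₁`, `u₂` and incoherent
control `n` (note that `σmᴴ = σp` and `σpᴴ = σm`). -/
def masterField (ω γ κ₁ κ₂ u₁ u₂ n : ℝ) (ρ : Matrix (Fin 2) (Fin 2) ℂ) :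
    Matrix (Fin 2) (Fin 2) ℂ :=
  (-Complex.I) • (hamiltonian ω κ₁ κ₂ u₁ u₂ * ρ - ρ * hamiltonian ω κ₁ κ₂ u₁ u₂)
    + ((γ * (n + 1) : ℝ) : ℂ) • dissipator σm ρ
    + ((γ * n : ℝ) : ℂ) • dissipator σp ρ

/-- `ρ` is a (Carathéodory) trajectory on `[0, T]` of the master equation for the given controls,
in integral form and entry by entry. -/
def IsMasterTrajectory (ω γ κ₁ κ₂ T : ℝ) (u₁ u₂ n : ℝ → ℝ)
    (ρ : ℝ → Matrix (Fin 2) (Fin 2) ℂ) : Prop :=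
  ContinuousOn ρ (Set.Icc 0 T) ∧
    ∀ t ∈ Set.Icc 0 T, ∀ i j, ρ t i j =
      ρ 0 i j + ∫ s in (0 : ℝ)..t, masterField ω γ κ₁ κ₂ (u₁ s) (u₂ s) (n s) (ρ s) i j

/-- The matrices exactly reachable from `ρ₀` in finite time by integrable coherent controls, the
incoherent control being identically zero. -/
def masterReachableSet (ω γ κ₁ κ₂ : ℝ) (ρ₀ : Matrix (Fin 2) (Fin 2) ℂ) :
    Set (Matrix (Fin 2) (Fin 2) ℂ) :=
  {ρ₁ | ∃ T : ℝ, 0 ≤ T ∧ ∃ u₁ u₂ : ℝ → ℝ,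
    IntervalIntegrable u₁ volume 0 T ∧ IntervalIntegrable u₂ volume 0 T ∧
    ∃ ρ : ℝ → Matrix (Fin 2) (Fin 2) ℂ,
      IsMasterTrajectory ω γ κ₁ κ₂ T u₁ u₂ (fun _ => 0) ρ ∧ ρ 0 = ρ₀ ∧ ρ T = ρ₁}

end QubitControl

end

namespace QubitControl

/-! ### Trajectories of the Bloch system -/

/-! Coherent controls act tangentially to spheres, so in spherical coordinates the radius obeys a
linear equation depending only on the polar angle, `R' = γ cos θ - γ (1 + cos² θ) / 2 * R`. Away
from the origin, and with the azimuth left to turn with the drift, the controls can impose any speed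
on `θ` (`spherical_mem_blochReachableSet`). A fast sweep of `θ` therefore reaches any polar angle
with an arbitrarily small change of `R` (`exists_spherical_trajectory`).

Such sweeps take the initial point to the `z` axis and, with the radial equation solved backwards
from the target, the axis to the final point. On the axis, relaxation alone moves the state up. To
go down, it relaxes to a height `c` close to `1`, is flipped to about `-c`, and relaxes up again
(`zAxis_connected`).

For matrices, the Bloch map is affine and intertwines the two dynamics, with `ω` replaced by `2 *
ω`. The determinant is `(1 - ‖r‖²) / 4`, so non-pure states have Bloch vectors in the open ball. -/

theorem hasDerivAt_vec3 {a b c : ℝ → ℝ} {a' b' c' t : ℝ} (ha : HasDerivAt a a' t)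
    (hb : HasDerivAt b b' t) (hc : HasDerivAt c c' t) :
    HasDerivAt (fun s => (!₂[a s, b s, c s] : EuclideanSpace ℝ (Fin 3))) !₂[a', b', c'] t := by
  have h : HasDerivAt (fun s => ![a s, b s, c s]) ![a', b', c'] t := by
    rw [hasDerivAt_pi]
    intro i
    fin_cases i
    · exact ha
    · exact hb
    · exact hc
  exact ((PiLp.continuousLinearEquiv 2 ℝ
    (fun _ : Fin 3 => ℝ)).symm.toContinuousLinearMap.hasFDerivAt.comp_hasDerivAt t h)

theorem continuous_vec3 {X : Type*} [TopologicalSpace X] {a b c : X → ℝ} (ha : Continuous a)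
    (hb : Continuous b) (hc : Continuous c) :
    Continuous (fun s => (!₂[a s, b s, c s] : EuclideanSpace ℝ (Fin 3))) := by
  refine (PiLp.continuous_toLp 2 _).comp (continuous_pi fun i => ?_)
  fin_cases i
  · exact ha
  · exact hb
  · exact hc

theorem continuous_f₀ (ω γ : ℝ) : Continuous (f₀ ω γ) :=
  continuous_vec3 (by fun_prop) (by fun_prop) (by fun_prop)

theorem continuous_fx : Continuous fx :=
  continuous_vec3 (by fun_prop) (by fun_prop) (by fun_prop)

theorem continuous_fy : Continuous fy :=
  continuous_vec3 (by fun_prop) (by fun_prop) (by fun_prop)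

theorem intervalIntegrable_blochField {ω γ κ₁ κ₂ a b : ℝ} {u₁ u₂ : ℝ → ℝ}
    {r : ℝ → EuclideanSpace ℝ (Fin 3)} (h₁ : IntervalIntegrable u₁ volume a b)
    (h₂ : IntervalIntegrable u₂ volume a b) (hr : ContinuousOn r (Set.uIcc a b)) :
    IntervalIntegrable (fun s => blochField ω γ κ₁ κ₂ (u₁ s) (u₂ s) (r s)) volume a b := by
  refine ((ContinuousOn.intervalIntegrable ?_).add ?_).add ?_
  · exact ((continuous_f₀ ω γ).comp_continuousOn hr).const_smul ω
  · exact (h₁.const_mul (2 * κ₁)).smul_continuousOn (continuous_fx.comp_continuousOn hr)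
  · exact (h₂.const_mul (2 * κ₂)).smul_continuousOn (continuous_fy.comp_continuousOn hr)

/-- A differentiable solution with continuous controls is a trajectory. -/
theorem mem_blochReachableSet_of_hasDerivAt {ω γ κ₁ κ₂ T : ℝ} (hT : 0 ≤ T) {u₁ u₂ : ℝ → ℝ}
    {r : ℝ → EuclideanSpace ℝ (Fin 3)} (h₁ : ContinuousOn u₁ (Set.Icc 0 T))
    (h₂ : ContinuousOn u₂ (Set.Icc 0 T))
    (hr : ∀ t ∈ Set.Icc 0 T, HasDerivAt r (blochField ω γ κ₁ κ₂ (u₁ t) (u₂ t) (r t)) t) :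
    r T ∈ blochReachableSet ω γ κ₁ κ₂ (r 0) := by
  have hu : Set.uIcc 0 T = Set.Icc 0 T := Set.uIcc_of_le hT
  have hrc : ContinuousOn r (Set.Icc 0 T) := fun t ht => (hr t ht).continuousAt.continuousWithinAt
  have hi₁ : IntervalIntegrable u₁ volume 0 T := ContinuousOn.intervalIntegrable (hu ▸ h₁)
  have hi₂ : IntervalIntegrable u₂ volume 0 T := ContinuousOn.intervalIntegrable (hu ▸ h₂)
  refine ⟨T, hT, u₁, u₂, hi₁, hi₂, r, ⟨hrc, fun t ht => ?_⟩, rfl, rfl⟩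
  have hsub : Set.uIcc 0 t ⊆ Set.uIcc 0 T := by
    rw [hu, Set.uIcc_of_le ht.1]; exact Set.Icc_subset_Icc_right ht.2
  rw [intervalIntegral.integral_eq_sub_of_hasDerivAt (fun x hx => hr x (hu ▸ hsub hx))
    ((intervalIntegrable_blochField hi₁ hi₂ (hu ▸ hrc)).mono_set hsub)]
  abel

theorem self_mem_blochReachableSet (ω γ κ₁ κ₂ : ℝ) (r : EuclideanSpace ℝ (Fin 3)) :
    r ∈ blochReachableSet ω γ κ₁ κ₂ r := by
  refine ⟨0, le_rfl, 0, 0, IntervalIntegrable.refl, IntervalIntegrable.refl, fun _ => r,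
    ⟨continuousOn_const, fun t ht => ?_⟩, rfl, rfl⟩
  obtain rfl : t = 0 := le_antisymm ht.2 ht.1
  simp

theorem intervalIntegrable_concat {u v : ℝ → ℝ} {T S : ℝ} (hT : 0 ≤ T) (hS : 0 ≤ S)
    (hu : IntervalIntegrable u volume 0 T) (hv : IntervalIntegrable v volume 0 S) :
    IntervalIntegrable (fun t => if t ≤ T then u t else v (t - T)) volume 0 (T + S) := by
  refine (hu.congr fun t ht => ?_).trans (b := T)
    ((by simpa [add_comm] using hv.comp_sub_right T :
      IntervalIntegrable (fun t => v (t - T)) volume T (T + S)).congr fun t ht => ?_)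
  · rw [Set.uIoc_of_le hT] at ht
    exact (if_pos ht.2).symm
  · rw [Set.uIoc_of_le (by linarith)] at ht
    exact (if_neg (not_le.2 ht.1)).symm

/-- Trajectories can be concatenated. -/
theorem blochReachableSet_trans {ω γ κ₁ κ₂ : ℝ} {a b c : EuclideanSpace ℝ (Fin 3)}
    (hab : b ∈ blochReachableSet ω γ κ₁ κ₂ a) (hbc : c ∈ blochReachableSet ω γ κ₁ κ₂ b) :
    c ∈ blochReachableSet ω γ κ₁ κ₂ a := by
  obtain ⟨T, hT, u₁, u₂, hu₁, hu₂, r, ⟨hrc, hr⟩, r0, rT⟩ := hab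
  obtain ⟨S, hS, v₁, v₂, hv₁, hv₂, q, ⟨hqc, hq⟩, q0, qS⟩ := hbc
  set w₁ : ℝ → ℝ := fun t => if t ≤ T then u₁ t else v₁ (t - T) with hw₁
  set w₂ : ℝ → ℝ := fun t => if t ≤ T then u₂ t else v₂ (t - T) with hw₂
  set p : ℝ → EuclideanSpace ℝ (Fin 3) := fun t => if t ≤ T then r t else q (t - T) with hp
  have hi₁ := intervalIntegrable_concat hT hS hu₁ hv₁
  have hi₂ := intervalIntegrable_concat hT hS hu₂ hv₂
  have hpr : ∀ t, t ≤ T → p t = r t := fun t ht => if_pos ht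
  -- The endpoint `t = T` is included because both pieces take the value `b` there.
  have hpq : ∀ t, T ≤ t → p t = q (t - T) := by
    intro t ht
    rcases ht.eq_or_lt with rfl | ht
    · rw [hpr _ le_rfl, rT, sub_self, q0]
    · exact if_neg (not_le.2 ht)
  have hpc : ContinuousOn p (Set.Icc 0 (T + S)) := by
    rw [← Set.Icc_union_Icc_eq_Icc hT (by linarith : T ≤ T + S)]
    refine ContinuousOn.union_of_isClosed ?_ ?_ isClosed_Icc isClosed_Icc
    · exact hrc.congr fun t ht => hpr t ht.2
    · refine ContinuousOn.congr (f := fun t => q (t - T)) ?_ fun t ht => hpq t ht.1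
      exact hqc.comp (by fun_prop) fun t ht => ⟨by linarith [ht.1], by linarith [ht.2]⟩
  have hint : IntervalIntegrable (fun s => blochField ω γ κ₁ κ₂ (w₁ s) (w₂ s) (p s)) volume 0
      (T + S) :=
    intervalIntegrable_blochField hi₁ hi₂ (by rwa [Set.uIcc_of_le (by linarith)])
  have hfst : ∀ t ∈ Set.Icc 0 T, p t = r 0 +
      ∫ s in (0 : ℝ)..t, blochField ω γ κ₁ κ₂ (w₁ s) (w₂ s) (p s) := by
    intro t ht
    rw [hpr t ht.2, hr t ht]
    congr 1
    refine intervalIntegral.integral_congr fun s hs => ?_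
    rw [Set.uIcc_of_le ht.1] at hs
    have hsT : s ≤ T := hs.2.trans ht.2
    simp only [hw₁, hw₂, hp, if_pos hsT]
  refine ⟨T + S, by linarith, w₁, w₂, hi₁, hi₂, p, ⟨hpc, fun t ht => ?_⟩, ?_, ?_⟩
  · rw [hpr 0 hT]
    rcases le_total t T with htT | htT
    · exact hfst t ⟨ht.1, htT⟩
    · have hsub₁ : Set.uIcc 0 T ⊆ Set.uIcc 0 (T + S) := by
        rw [Set.uIcc_of_le hT, Set.uIcc_of_le (by linarith)]
        exact Set.Icc_subset_Icc_right (by linarith)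
      have hsub₂ : Set.uIcc T t ⊆ Set.uIcc 0 (T + S) := by
        rw [Set.uIcc_of_le htT, Set.uIcc_of_le (by linarith)]
        exact Set.Icc_subset_Icc hT ht.2
      rw [← intervalIntegral.integral_add_adjacent_intervals (hint.mono_set hsub₁)
        (hint.mono_set hsub₂), ← add_assoc, ← hfst T ⟨hT, le_rfl⟩, hpr T le_rfl, hpq t htT, rT,
        ← q0, hq (t - T) ⟨by linarith, by linarith [ht.2]⟩]
      congr 1
      have hshift := intervalIntegral.integral_comp_sub_right (a := T) (b := t)
        (fun s => blochField ω γ κ₁ κ₂ (v₁ s) (v₂ s) (q s)) T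
      rw [sub_self] at hshift
      rw [← hshift]
      -- The half-open interval excludes `s = T`, where the concatenated controls still take their
      -- first-leg values.
      refine intervalIntegral.integral_congr_ae (Filter.Eventually.of_forall fun s hs => ?_)
      rw [Set.uIoc_of_le htT] at hs
      simp only [hw₁, hw₂, hp, if_neg (not_le.2 hs.1)]
  · rw [hpr 0 hT, r0]
  · rw [hpq _ (by linarith), add_sub_cancel_left, qS]

/-! ### Motion in a rotating meridian plane -/

/-- Scalar linear equations `R' = p - q R` with bounded coefficients have solutions with a
prescribed value at `t₀`, which do not move far in a short time. -/
theorem exists_solution_linear_ode {p q : ℝ → ℝ} (hp : Continuous p) (hq : Continuous q)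
    {γ : ℝ} (hpγ : ∀ t, |p t| ≤ γ) (hqγ : ∀ t, |q t| ≤ γ) {R₀ : ℝ} (hR₀ : |R₀| ≤ 1) (t₀ : ℝ) :
    ∃ R : ℝ → ℝ, R t₀ = R₀ ∧ (∀ t, HasDerivAt R (p t - q t * R t) t) ∧
      ∀ t, γ * |t - t₀| ≤ 1 → |R t - R₀| ≤ 14 * (γ * |t - t₀|) := by
  -- Variation of constants, based at `t₀`: the solution is `exp (-A) * (R₀ + B)`.
  set A : ℝ → ℝ := fun t => ∫ s in t₀..t, q s with hA
  have hAd : ∀ t, HasDerivAt A (q t) t := fun t => (hq.integral_hasStrictDerivAt t₀ t).hasDerivAt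
  have hAc : Continuous A := continuous_iff_continuousAt.2 fun t => (hAd t).continuousAt
  have hpc : Continuous fun s => p s * Real.exp (A s) := by fun_prop
  set B : ℝ → ℝ := fun t => ∫ s in t₀..t, p s * Real.exp (A s) with hB
  have hBd : ∀ t, HasDerivAt B (p t * Real.exp (A t)) t :=
    fun t => (hpc.integral_hasStrictDerivAt t₀ t).hasDerivAt
  have hγ : 0 ≤ γ := (abs_nonneg _).trans (hpγ 0)
  have hAb : ∀ t, |A t| ≤ γ * |t - t₀| := by
    intro t
    rw [hA, ← Real.norm_eq_abs]
    exact intervalIntegral.norm_integral_le_of_norm_le_const fun s _ => hqγ s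
  have hexp : ∀ x : ℝ, x ≤ 1 → Real.exp x ≤ 3 := fun x hx =>
    (Real.exp_le_exp.2 hx).trans Real.exp_one_lt_three.le
  refine ⟨fun t => Real.exp (-A t) * (R₀ + B t), by simp [hA, hB], fun t => ?_, fun t ht => ?_⟩
  · refine ((hAd t).neg.exp.mul ((hBd t).const_add R₀)).congr_deriv ?_
    have : Real.exp (-A t) * Real.exp (A t) = 1 := by rw [← Real.exp_add]; simp
    linear_combination p t * this
  · have hBb : |B t| ≤ γ * 3 * |t - t₀| := by
      rw [hB, ← Real.norm_eq_abs]
      refine intervalIntegral.norm_integral_le_of_norm_le_const fun s hs => ?_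
      have hst : |s - t₀| ≤ |t - t₀| := Set.abs_sub_left_of_mem_uIcc (Set.uIoc_subset_uIcc hs)
      rw [Real.norm_eq_abs, abs_mul, Real.abs_exp]
      refine mul_le_mul (hpγ s) (hexp _ ?_) (Real.exp_nonneg _) hγ
      calc A s ≤ |A s| := le_abs_self _
        _ ≤ γ * |s - t₀| := hAb s
        _ ≤ γ * |t - t₀| := by gcongr
        _ ≤ 1 := ht
    have h1 : |Real.exp (-A t) - 1| ≤ 2 * (γ * |t - t₀|) := by
      refine (Real.abs_exp_sub_one_le (by rw [abs_neg]; exact (hAb t).trans ht)).trans ?_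
      rw [abs_neg]
      linarith [hAb t]
    have h2 : Real.exp (-A t) ≤ 3 :=
      hexp _ ((neg_le_abs _).trans ((hAb t).trans ht))
    have h3 : Real.exp (-A t) * (R₀ + B t) - R₀ =
      (Real.exp (-A t) - 1) * R₀ + Real.exp (-A t) * B t := by ring
    rw [h3]
    refine (abs_add_le _ _).trans ?_
    rw [abs_mul, abs_mul, Real.abs_exp]
    have h4 : |Real.exp (-A t) - 1| * |R₀| ≤ 2 * (γ * |t - t₀|) * 1 :=
      mul_le_mul h1 hR₀ (abs_nonneg _) (by positivity)
    have h5 : Real.exp (-A t) * |B t| ≤ 3 * (γ * 3 * |t - t₀|) :=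
      mul_le_mul h2 hBb (abs_nonneg _) (by norm_num)
    -- The two terms give `2 + 9 = 11`; the constant `14` is not sharp.
    nlinarith [mul_nonneg hγ (abs_nonneg (t - t₀))]

/-- The point with spherical coordinates `R, θ, φ`. -/
noncomputable def spherical (R θ φ : ℝ) : EuclideanSpace ℝ (Fin 3) :=
  !₂[R * Real.sin θ * Real.cos φ, R * Real.sin θ * Real.sin φ, R * Real.cos θ]

theorem spherical_zero (R φ : ℝ) : spherical R 0 φ = !₂[0, 0, R] := by
  simp [spherical]

theorem spherical_pi (R φ : ℝ) : spherical R Real.pi φ = !₂[0, 0, -R] := by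
  simp [spherical]

/-- If the radius obeys the radial part of the dynamics, then a rotation of the polar angle in the
meridian plane that turns with the drift is realized by suitable coherent controls. -/
theorem spherical_mem_blochReachableSet {ω γ κ₁ κ₂ T : ℝ} (hω : ω ≠ 0) (hκ₁ : κ₁ ≠ 0)
    (hκ₂ : κ₂ ≠ 0) (hT : 0 ≤ T) {θ R : ℝ → ℝ} {k : ℝ} (φ₀ : ℝ) (hθ : ∀ t, HasDerivAt θ k t)
    (hR : ∀ t ∈ Set.Icc 0 T, HasDerivAt R
      (γ * Real.cos (θ t) - γ * (1 + Real.cos (θ t) ^ 2) / 2 * R t) t)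
    (hRpos : ∀ t ∈ Set.Icc 0 T, R t ≠ 0) :
    spherical (R T) (θ T) (φ₀ + ω * T) ∈
      blochReachableSet ω γ κ₁ κ₂ (spherical (R 0) (θ 0) φ₀) := by
  have hθc : Continuous θ := continuous_iff_continuousAt.2 fun t => (hθ t).continuousAt
  have hRc : ContinuousOn R (Set.Icc 0 T) := fun t ht => (hR t ht).continuousAt.continuousWithinAt
  -- The desired speed `k` plus a correction cancelling the component of the relaxation along the
  -- meridian; division by `R` is why the radius must not vanish.
  set v : ℝ → ℝ := fun t => k + γ / 2 * Real.sin (θ t) * Real.cos (θ t) +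
    γ * (1 - R t * Real.cos (θ t)) * Real.sin (θ t) / R t with hv
  have hvc : ContinuousOn v (Set.Icc 0 T) := by
    refine ContinuousOn.add (by fun_prop) (ContinuousOn.div (by fun_prop) hRc hRpos)
  have key := mem_blochReachableSet_of_hasDerivAt (ω := ω) (γ := γ) (κ₁ := κ₁) (κ₂ := κ₂)
    -- Rotation at speed `v` about the horizontal axis `(-sin φ, cos φ, 0)`, normal to the meridian
    -- plane at azimuth `φ = φ₀ + ω t`.
    (u₁ := fun t => -(v t * Real.sin (φ₀ + ω * t)) / (2 * κ₁))
    (u₂ := fun t => (v t * Real.cos (φ₀ + ω * t)) / (2 * κ₂))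
    (r := fun t => spherical (R t) (θ t) (φ₀ + ω * t)) hT
    (by fun_prop) (by fun_prop) ?_
  · simpa using key
  intro t ht
  have hφ : HasDerivAt (fun s => φ₀ + ω * s) ω t := by
    simpa using ((hasDerivAt_id t).const_mul ω).const_add φ₀
  refine (hasDerivAt_vec3 (((hR t ht).mul (hθ t).sin).mul hφ.cos)
    (((hR t ht).mul (hθ t).sin).mul hφ.sin) ((hR t ht).mul (hθ t).cos)).congr_deriv ?_
  have hV : v t * R t = k * R t + γ / 2 * Real.sin (θ t) * Real.cos (θ t) * R t +
      γ * (1 - R t * Real.cos (θ t)) * Real.sin (θ t) := by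
    simp only [hv, add_mul, div_mul_cancel₀ _ (hRpos t ht)]
  have h₁ : 2 * κ₁ * (-(v t * Real.sin (φ₀ + ω * t)) / (2 * κ₁)) =
      -(v t * Real.sin (φ₀ + ω * t)) := by field_simp
  have h₂ : 2 * κ₂ * (v t * Real.cos (φ₀ + ω * t) / (2 * κ₂)) =
      v t * Real.cos (φ₀ + ω * t) := by field_simp
  have hω' : ω * (γ / ω) = γ := mul_div_cancel₀ _ hω
  have hs := Real.sin_sq_add_cos_sq (θ t)
  have hs' := Real.sin_sq_add_cos_sq (φ₀ + ω * t)
  simp only [blochField, h₁, h₂, f₀, fx, fy, spherical]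
  ext i
  fin_cases i <;> simp
  · linear_combination (-(Real.cos (θ t) * Real.cos (φ₀ + ω * t))) * hV +
      R t * Real.sin (θ t) * Real.cos (φ₀ + ω * t) / 2 * hω'
  · linear_combination (-(Real.cos (θ t) * Real.sin (φ₀ + ω * t))) * hV +
      R t * Real.sin (θ t) * Real.sin (φ₀ + ω * t) / 2 * hω'
  · linear_combination Real.sin (θ t) * hV + (γ - R t * γ * Real.cos (θ t) / 2) * hs +
      v t * R t * Real.sin (θ t) * hs' + (R t * Real.cos (θ t) - 1) * hω'

/-- The radial drift is bounded while the sweep of `θ` can be arbitrarily fast. The radius is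
prescribed at a free time `t₀`, so that `t₀ = 0` serves for leaving a given point and `t₀ = T` for
arriving at one. -/
theorem exists_spherical_trajectory {ω γ κ₁ κ₂ : ℝ} (hω : ω ≠ 0) (hγ : 0 < γ) (hκ₁ : κ₁ ≠ 0)
    (hκ₂ : κ₂ ≠ 0) {R₀ δ : ℝ} (hR₁ : R₀ ≤ 1) (hδ : 0 < δ) (hδR : δ ≤ R₀) (θ₀ θ₁ : ℝ) :
    ∃ T, 0 ≤ T ∧ ∀ t₀ ∈ Set.Icc 0 T, ∃ R : ℝ → ℝ, R t₀ = R₀ ∧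
      (∀ t ∈ Set.Icc 0 T, |R t - R₀| < δ) ∧
      ∀ φ₀, spherical (R T) θ₁ (φ₀ + ω * T) ∈
        blochReachableSet ω γ κ₁ κ₂ (spherical (R 0) θ₀ φ₀) := by
  -- `γ T ≤ 1` makes the radial estimate applicable, and `14 * (δ / 15) < δ`.
  set T := min 1 (δ / 15) / γ with hTdef
  have hm : 0 < min 1 (δ / 15) := lt_min one_pos (by positivity)
  have hT : 0 < T := div_pos hm hγ
  have hγT : γ * T = min 1 (δ / 15) := mul_div_cancel₀ _ hγ.ne'
  refine ⟨T, hT.le, fun t₀ ht₀ => ?_⟩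
  set θ : ℝ → ℝ := fun t => θ₀ + (θ₁ - θ₀) / T * t with hθ
  have hθd : ∀ t, HasDerivAt θ ((θ₁ - θ₀) / T) t := fun t =>
    (((hasDerivAt_id t).const_mul ((θ₁ - θ₀) / T)).const_add θ₀).congr_deriv (mul_one _)
  have hθc : Continuous θ := by fun_prop
  obtain ⟨R, hR0, hRd, hRb⟩ := exists_solution_linear_ode
    (p := fun t => γ * Real.cos (θ t)) (q := fun t => γ * (1 + Real.cos (θ t) ^ 2) / 2)
    (by fun_prop) (by fun_prop) (γ := γ)
    (fun t => by
      rw [abs_mul, abs_of_pos hγ]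
      exact mul_le_of_le_one_right hγ.le (Real.abs_cos_le_one _))
    (fun t => by
      rw [abs_of_nonneg (by positivity)]
      nlinarith [Real.cos_sq_le_one (θ t)])
    (R₀ := R₀) (abs_le.2 ⟨by linarith, hR₁⟩) t₀
  have hb : ∀ t ∈ Set.Icc 0 T, |R t - R₀| < δ := by
    intro t ht
    have h1 : γ * |t - t₀| ≤ γ * T :=
      mul_le_mul_of_nonneg_left
        (abs_sub_le_iff.2 ⟨by linarith [ht.2, ht₀.1], by linarith [ht.1, ht₀.2]⟩) hγ.le
    have h2 := min_le_left 1 (δ / 15)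
    have h3 := min_le_right 1 (δ / 15)
    have h4 := hRb t (by linarith)
    linarith
  refine ⟨R, hR0, hb, fun φ₀ => ?_⟩
  have key := spherical_mem_blochReachableSet hω hκ₁ hκ₂ hT.le φ₀ hθd (fun t _ => hRd t)
    (fun t ht => by have := (abs_lt.1 (hb t ht)).1; linarith)
  have e0 : θ 0 = θ₀ := by simp [hθ]
  have e1 : θ T = θ₁ := by simp only [hθ]; field_simp; ring
  rwa [e0, e1] at key

/-- Any polar angle is attained, with arbitrarily small change of the radius. -/
theorem exists_reachable_polar_angle {ω γ κ₁ κ₂ : ℝ} (hω : ω ≠ 0) (hγ : 0 < γ) (hκ₁ : κ₁ ≠ 0)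
    (hκ₂ : κ₂ ≠ 0) {R₀ δ : ℝ} (hR₁ : R₀ ≤ 1) (hδ : 0 < δ) (hδR : δ ≤ R₀) (θ₀ θ₁ φ₀ : ℝ) :
    ∃ R φ, |R - R₀| < δ ∧
      spherical R θ₁ φ ∈ blochReachableSet ω γ κ₁ κ₂ (spherical R₀ θ₀ φ₀) := by
  obtain ⟨T, hT, h⟩ := exists_spherical_trajectory hω hγ hκ₁ hκ₂ hR₁ hδ hδR θ₀ θ₁
  obtain ⟨R, hR0, hb, hr⟩ := h 0 ⟨le_rfl, hT⟩
  exact ⟨R T, φ₀ + ω * T, hb T ⟨hT, le_rfl⟩, hR0 ▸ hr φ₀⟩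

/-- A given point is reached from any polar angle, with arbitrarily small change of the radius. -/
theorem exists_polar_angle_reaching {ω γ κ₁ κ₂ : ℝ} (hω : ω ≠ 0) (hγ : 0 < γ) (hκ₁ : κ₁ ≠ 0)
    (hκ₂ : κ₂ ≠ 0) {R₀ δ : ℝ} (hR₁ : R₀ ≤ 1) (hδ : 0 < δ) (hδR : δ ≤ R₀) (θ₀ θ₁ φ₁ : ℝ) :
    ∃ R φ, |R - R₀| < δ ∧
      spherical R₀ θ₁ φ₁ ∈ blochReachableSet ω γ κ₁ κ₂ (spherical R θ₀ φ) := by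
  obtain ⟨T, hT, h⟩ := exists_spherical_trajectory hω hγ hκ₁ hκ₂ hR₁ hδ hδR θ₀ θ₁
  obtain ⟨R, hR0, hb, hr⟩ := h T ⟨hT, le_rfl⟩
  refine ⟨R 0, φ₁ - ω * T, hb 0 ⟨le_rfl, hT⟩, ?_⟩
  have := hr (φ₁ - ω * T)
  rwa [hR0, sub_add_cancel] at this

/-! ### Motion along the `z` axis -/

/-- Without controls the state moves upwards on the `z` axis. -/
theorem zAxis_up {ω γ κ₁ κ₂ a b : ℝ} (hω : ω ≠ 0) (hγ : 0 < γ) (hab : a ≤ b) (hb : b < 1) :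
    (!₂[0, 0, b] : EuclideanSpace ℝ (Fin 3)) ∈ blochReachableSet ω γ κ₁ κ₂ !₂[0, 0, a] := by
  have hb' : 0 < 1 - b := by linarith
  have ha' : 0 < 1 - a := by linarith
  -- The distance `1 - z` decays like `exp (-γ t)`; this is the time it takes from `1 - a` to `1 -
  -- b`.
  set T := Real.log ((1 - a) / (1 - b)) / γ with hT
  have hT0 : 0 ≤ T := div_nonneg (Real.log_nonneg ((one_le_div hb').2 (by linarith))) hγ.le
  have key := mem_blochReachableSet_of_hasDerivAt (ω := ω) (γ := γ) (κ₁ := κ₁) (κ₂ := κ₂)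
    (u₁ := fun _ => 0) (u₂ := fun _ => 0)
    (r := fun t => !₂[0, 0, 1 - (1 - a) * Real.exp (-(γ * t))]) hT0
    continuousOn_const continuousOn_const ?_
  · have e : Real.exp (-(γ * T)) = (1 - b) / (1 - a) := by
      rw [hT, mul_div_cancel₀ _ hγ.ne', Real.exp_neg, Real.exp_log (by positivity), inv_div]
    simpa [e, mul_div_cancel₀ _ ha'.ne'] using key
  · intro t _
    have hd : HasDerivAt (fun s => 1 - (1 - a) * Real.exp (-(γ * s)))
        (-((1 - a) * (Real.exp (-(γ * t)) * (-(γ * 1))))) t :=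
      ((((hasDerivAt_id t).const_mul γ).neg.exp.const_mul (1 - a)).const_sub 1)
    refine (hasDerivAt_vec3 (hasDerivAt_const t 0) (hasDerivAt_const t 0) hd).congr_deriv ?_
    have hω' : ω * (γ / ω) = γ := mul_div_cancel₀ _ hω
    simp only [blochField, f₀, fx, fy]
    ext i
    fin_cases i <;> simp
    linear_combination (-((1 - a) * Real.exp (-(γ * t)))) * hω'

theorem zAxis_connected {ω γ κ₁ κ₂ a b : ℝ} (hω : ω ≠ 0) (hγ : 0 < γ) (hκ₁ : κ₁ ≠ 0)
    (hκ₂ : κ₂ ≠ 0) (ha : a < 1) (hb : -1 < b) (hb' : b < 1) :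
    (!₂[0, 0, b] : EuclideanSpace ℝ (Fin 3)) ∈ blochReachableSet ω γ κ₁ κ₂ !₂[0, 0, a] := by
  -- `c > a` is reached by relaxation, `c > 0` permits the flip, and `c > -b` puts `-c` below `b`;
  -- tolerance `c + b` keeps the flipped point below `b`.
  obtain ⟨c, hc, hc1⟩ := exists_between (max_lt (max_lt ha one_pos) (neg_lt.1 hb))
  simp only [max_lt_iff] at hc
  obtain ⟨⟨hac, hc0⟩, hbc⟩ := hc
  obtain ⟨R, φ, hR, hr⟩ := exists_reachable_polar_angle (κ₁ := κ₁) (κ₂ := κ₂) hω hγ hκ₁ hκ₂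
    hc1.le (lt_min hc0 (by linarith : 0 < c + b)) (min_le_left _ _) 0 Real.pi 0
  rw [spherical_zero, spherical_pi] at hr
  have h1 := (abs_lt.1 (hR.trans_le (min_le_right _ _))).1
  exact blochReachableSet_trans (zAxis_up hω hγ hac.le hc1)
    (blochReachableSet_trans hr (zAxis_up hω hγ (by linarith) hb'))

/-! ### Controllability in the interior of the Bloch ball -/

/-- Planar polar coordinates used twice: for `(x, y)`, then for `z` and the distance to the axis. -/
theorem exists_eq_spherical (r : EuclideanSpace ℝ (Fin 3)) : ∃ θ φ, r = spherical ‖r‖ θ φ := by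
  have polar : ∀ x y : ℝ, ∃ φ, x = √(x ^ 2 + y ^ 2) * Real.cos φ ∧
      y = √(x ^ 2 + y ^ 2) * Real.sin φ := by
    intro x y
    have h : ‖(⟨x, y⟩ : ℂ)‖ = √(x ^ 2 + y ^ 2) := by
      rw [Complex.norm_def, Complex.normSq_mk, sq, sq]
    exact ⟨Complex.arg ⟨x, y⟩, by rw [← h, Complex.norm_mul_cos_arg],
      by rw [← h, Complex.norm_mul_sin_arg]⟩
  obtain ⟨φ, hx, hy⟩ := polar (r 0) (r 1)
  obtain ⟨θ, hz, hρ⟩ := polar (r 2) √(r 0 ^ 2 + r 1 ^ 2)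
  have hn : ‖r‖ = √(r 2 ^ 2 + √(r 0 ^ 2 + r 1 ^ 2) ^ 2) := by
    rw [EuclideanSpace.norm_eq, Real.sq_sqrt (by positivity), Fin.sum_univ_three]
    simp only [Real.norm_eq_abs, sq_abs]
    ring_nf
  refine ⟨θ, φ, ?_⟩
  rw [spherical, hn, ← hρ, ← hz, ← hx, ← hy]
  ext i
  fin_cases i <;> rfl

/-- The Bloch system is completely controllable in the open unit ball. -/
theorem mem_blochReachableSet_of_norm_lt_one {ω γ κ₁ κ₂ : ℝ} (hω : ω ≠ 0) (hγ : 0 < γ)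
    (hκ₁ : κ₁ ≠ 0) (hκ₂ : κ₂ ≠ 0) {r₀ r₁ : EuclideanSpace ℝ (Fin 3)} (h₀ : ‖r₀‖ < 1)
    (h₁ : ‖r₁‖ < 1) : r₁ ∈ blochReachableSet ω γ κ₁ κ₂ r₀ := by
  have hzero : (0 : EuclideanSpace ℝ (Fin 3)) = !₂[0, 0, 0] := by
    ext i; fin_cases i <;> rfl
  have start : ∃ a < 1, (!₂[0, 0, a] : EuclideanSpace ℝ (Fin 3)) ∈
      blochReachableSet ω γ κ₁ κ₂ r₀ := by
    -- The origin, where the sweep is unavailable, already lies on the axis. Elsewhere the tolerance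
    -- `min ‖r₀‖ (1 - ‖r₀‖)` keeps the radius in `(0, 1)`.
    rcases eq_or_ne r₀ 0 with rfl | hr
    · exact ⟨0, one_pos, hzero ▸ self_mem_blochReachableSet ω γ κ₁ κ₂ _⟩
    · obtain ⟨θ, φ, he⟩ := exists_eq_spherical r₀
      have hpos := norm_pos_iff.2 hr
      obtain ⟨R, φ', hR, h⟩ := exists_reachable_polar_angle (κ₁ := κ₁) (κ₂ := κ₂) hω hγ hκ₁ hκ₂
        h₀.le (lt_min hpos (sub_pos.2 h₀)) (min_le_left _ _) θ 0 φ
      rw [← he, spherical_zero] at h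
      exact ⟨R, by linarith [(abs_lt.1 (hR.trans_le (min_le_right _ _))).2], h⟩
  have finish : ∃ b, -1 < b ∧ b < 1 ∧
      r₁ ∈ blochReachableSet ω γ κ₁ κ₂ (!₂[0, 0, b] : EuclideanSpace ℝ (Fin 3)) := by
    rcases eq_or_ne r₁ 0 with rfl | hr
    · exact ⟨0, by norm_num, one_pos, hzero ▸ self_mem_blochReachableSet ω γ κ₁ κ₂ _⟩
    · obtain ⟨θ, φ, he⟩ := exists_eq_spherical r₁
      have hpos := norm_pos_iff.2 hr
      obtain ⟨R, φ', hR, h⟩ := exists_polar_angle_reaching (κ₁ := κ₁) (κ₂ := κ₂) hω hγ hκ₁ hκ₂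
        h₁.le (lt_min hpos (sub_pos.2 h₁)) (min_le_left _ _) 0 θ φ
      rw [← he, spherical_zero] at h
      have hu := (abs_lt.1 (hR.trans_le (min_le_right _ _))).2
      have hl := (abs_lt.1 (hR.trans_le (min_le_left _ _))).1
      exact ⟨R, by linarith, by linarith, h⟩
  obtain ⟨a, ha, h⟩ := start
  obtain ⟨b, hb, hb', h'⟩ := finish
  exact blochReachableSet_trans h
    (blochReachableSet_trans (zAxis_connected hω hγ hκ₁ hκ₂ ha hb hb') h')

/-! ### Density matrices in the Bloch representation -/

/-- The traceless matrix `½ (x σ_x + y σ_y + z σ_z)`. -/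
noncomputable def pauliMatrix : EuclideanSpace ℝ (Fin 3) →ₗ[ℝ] Matrix (Fin 2) (Fin 2) ℂ where
  toFun r := (1 / 2 : ℂ) • ((r 0 : ℂ) • σx + (r 1 : ℂ) • σy + (r 2 : ℂ) • σz)
  map_add' r q := by
    simp only [PiLp.add_apply, Complex.ofReal_add, ← smul_add]
    module
  map_smul' c r := by
    ext i j
    simp [smul_eq_mul, Matrix.smul_apply, Matrix.add_apply]
    ring

theorem pauliMatrix_eq (r : EuclideanSpace ℝ (Fin 3)) : pauliMatrix r =
    !![(r 2 : ℂ) / 2, (r 0 - Complex.I * r 1) / 2; (r 0 + Complex.I * r 1) / 2, -(r 2 : ℂ) / 2] := by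
  ext i j
  fin_cases i <;> fin_cases j <;> simp [pauliMatrix, σx, σy, σz] <;> ring

/-- The density matrix with the given Bloch vector. -/
noncomputable def blochMatrix (r : EuclideanSpace ℝ (Fin 3)) : Matrix (Fin 2) (Fin 2) ℂ :=
  (1 / 2 : ℂ) • 1 + pauliMatrix r

theorem blochMatrix_eq (r : EuclideanSpace ℝ (Fin 3)) : blochMatrix r =
    !![(1 + r 2 : ℂ) / 2, (r 0 - Complex.I * r 1) / 2;
      (r 0 + Complex.I * r 1) / 2, (1 - r 2 : ℂ) / 2] := by
  rw [blochMatrix, pauliMatrix_eq]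
  ext i j
  fin_cases i <;> fin_cases j <;> simp <;> ring

/-- In the Bloch representation the master equation is the Bloch system with rotation rate
`2 ω`. -/
theorem masterField_blochMatrix {ω : ℝ} (hω : ω ≠ 0) (γ κ₁ κ₂ u₁ u₂ : ℝ)
    (r : EuclideanSpace ℝ (Fin 3)) : masterField ω γ κ₁ κ₂ u₁ u₂ 0 (blochMatrix r) =
      pauliMatrix (blochField (2 * ω) γ κ₁ κ₂ u₁ u₂ r) := by
  have hω' : (2 * ω) * (γ / (2 * ω)) = γ := by field_simp
  have e0 : blochField (2 * ω) γ κ₁ κ₂ u₁ u₂ r 0 =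
      -(2 * ω * r 1) - γ / 2 * r 0 + 2 * κ₂ * u₂ * r 2 := by
    simp [blochField, f₀, fx, fy]
    linear_combination (-(r 0 / 2)) * hω'
  have e1 : blochField (2 * ω) γ κ₁ κ₂ u₁ u₂ r 1 =
      2 * ω * r 0 - γ / 2 * r 1 - 2 * κ₁ * u₁ * r 2 := by
    simp [blochField, f₀, fx, fy]
    linear_combination (-(r 1 / 2)) * hω'
  have e2 : blochField (2 * ω) γ κ₁ κ₂ u₁ u₂ r 2 =
      γ * (1 - r 2) + 2 * κ₁ * u₁ * r 1 - 2 * κ₂ * u₂ * r 0 := by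
    simp [blochField, f₀, fx, fy]
    linear_combination (1 - r 2) * hω'
  rw [pauliMatrix_eq, e0, e1, e2, blochMatrix_eq]
  have hI := Complex.I_mul_I
  have hm : (!![0, 1; 0, 0] : Matrix (Fin 2) (Fin 2) ℂ)ᴴ = !![0, 0; 1, 0] := by
    ext i j
    fin_cases i <;> fin_cases j <;> simp
  ext i j
  fin_cases i <;> fin_cases j <;>
    simp [masterField, hamiltonian, dissipator, σx, σy, σz, σm, hm]
  · linear_combination (κ₂ * u₂ * r 0 - κ₁ * u₁ * r 1 : ℂ) * hI
  · linear_combination (ω * r 1 - κ₂ * u₂ * r 2 : ℂ) * hI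
  · linear_combination (ω * r 1 - κ₂ * u₂ * r 2 : ℂ) * hI
  · linear_combination (κ₁ * u₁ * r 1 - κ₂ * u₂ * r 0 : ℂ) * hI

theorem continuous_blochMatrix : Continuous blochMatrix := by
  have h : Continuous fun r => (1 / 2 : ℂ) • (1 : Matrix (Fin 2) (Fin 2) ℂ) +
      (1 / 2 : ℂ) • (((r : EuclideanSpace ℝ (Fin 3)) 0 : ℂ) • σx + (r 1 : ℂ) • σy +
        (r 2 : ℂ) • σz) := by fun_prop
  exact h

theorem blochMatrix_mem_masterReachableSet {ω γ κ₁ κ₂ : ℝ} (hω : ω ≠ 0)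
    {r₀ r₁ : EuclideanSpace ℝ (Fin 3)} (h : r₁ ∈ blochReachableSet (2 * ω) γ κ₁ κ₂ r₀) :
    blochMatrix r₁ ∈ masterReachableSet ω γ κ₁ κ₂ (blochMatrix r₀) := by
  obtain ⟨T, hT, u₁, u₂, hu₁, hu₂, r, ⟨hrc, hr⟩, r0, rT⟩ := h
  refine ⟨T, hT, u₁, u₂, hu₁, hu₂, fun t => blochMatrix (r t),
    ⟨continuous_blochMatrix.comp_continuousOn hrc, fun t ht i j => ?_⟩, congrArg _ r0, congrArg _ rT⟩
  -- Each entry of `pauliMatrix` is a continuous linear functional, hence commutes with the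
  -- integral; the constant `½ I` is carried by the initial value.
  let L : EuclideanSpace ℝ (Fin 3) →L[ℝ] ℂ :=
    (Matrix.entryLinearMap ℝ ℂ i j ∘ₗ pauliMatrix).toContinuousLinearMap
  have hL : ∀ v, pauliMatrix v i j = L v := fun _ => rfl
  have hsub : Set.uIcc 0 t ⊆ Set.uIcc 0 T := by
    rw [Set.uIcc_of_le hT, Set.uIcc_of_le ht.1]; exact Set.Icc_subset_Icc_right ht.2
  have hint := (intervalIntegrable_blochField (ω := 2 * ω) (γ := γ) (κ₁ := κ₁) (κ₂ := κ₂)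
    hu₁ hu₂ (by rwa [Set.uIcc_of_le hT])).mono_set hsub
  simp only [masterField_blochMatrix hω, hL]
  rw [L.intervalIntegral_comp_comm hint, blochMatrix, blochMatrix, Matrix.add_apply,
    Matrix.add_apply, hL, hL, hr t ht, map_add, add_assoc]

theorem exists_eq_blochMatrix {ρ : Matrix (Fin 2) (Fin 2) ℂ} (h : IsDensityMatrix ρ)
    (hp : ¬ IsPureState ρ) : ∃ r, ‖r‖ < 1 ∧ ρ = blochMatrix r := by
  have hherm := h.1.isHermitian
  have htr : ρ 0 0 + ρ 1 1 = 1 := by simpa [Matrix.trace_fin_two] using h.2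
  have him : (ρ 0 0).im = 0 := by
    simpa using congrArg Complex.im (hherm.coe_re_apply_self 0).symm
  have h10 : ρ 1 0 = star (ρ 0 1) := (hherm.apply 1 0).symm
  let r : EuclideanSpace ℝ (Fin 3) := !₂[2 * (ρ 0 1).re, -(2 * (ρ 0 1).im), 2 * (ρ 0 0).re - 1]
  have hρ : ρ = blochMatrix r := by
    rw [blochMatrix_eq]
    have h00 : ρ 0 0 = ((ρ 0 0).re : ℂ) := Complex.ext (by simp) (by simp [him])
    have h01 := Complex.re_add_im (ρ 0 1)
    ext i j
    fin_cases i <;> fin_cases j <;> simp [r]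
    · rw [← h00]
    · linear_combination -h01
    · rw [h10]
      apply Complex.ext <;> simp [neg_div]
    · rw [← h00]
      linear_combination htr
  refine ⟨r, ?_, hρ⟩
  have hn : ‖r‖ ^ 2 = r 0 ^ 2 + r 1 ^ 2 + r 2 ^ 2 := by
    rw [EuclideanSpace.norm_sq_eq, Fin.sum_univ_three]
    simp only [Real.norm_eq_abs, sq_abs]
  -- Positivity of `ρ` gives `‖r‖ ≤ 1` through the determinant; on the unit sphere `ρ` would be a
  -- projection.
  have hdet : ρ.det = (((1 - ‖r‖ ^ 2) / 4 : ℝ) : ℂ) := by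
    rw [hn, hρ, blochMatrix_eq, Matrix.det_fin_two_of]
    push_cast
    linear_combination (r 1 ^ 2 / 4 : ℂ) * Complex.I_mul_I
  have hle : ‖r‖ ^ 2 ≤ 1 := by
    have := h.1.det_nonneg
    rw [hdet, Complex.zero_le_real] at this
    linarith
  have hne : ‖r‖ ^ 2 ≠ 1 := by
    intro h1
    refine hp ⟨h, ?_⟩
    have h1' : (r 0 ^ 2 + r 1 ^ 2 + r 2 ^ 2 : ℂ) = 1 := by
      rw [hn] at h1
      exact_mod_cast h1
    rw [hρ, blochMatrix_eq, Matrix.mul_fin_two]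
    have hI := Complex.I_mul_I
    ext i j
    fin_cases i <;> fin_cases j <;> simp
    · linear_combination h1' / 4 - (r 1 ^ 2 / 4 : ℂ) * hI
    · ring
    · ring
    · linear_combination h1' / 4 - (r 1 ^ 2 / 4 : ℂ) * hI
  exact (sq_lt_one_iff₀ (norm_nonneg r)).1 (lt_of_le_of_ne hle hne)

end QubitControl

theorem mainTheorem4 (ω γ κ₁ κ₂ : ℝ) (hω : 0 < ω) (hγ : 0 < γ) (hκ₁ : 0 < κ₁) (hκ₂ : 0 < κ₂) :
    (∀ r₀ ∈ interior QubitControl.blochBall, ∀ r₁ ∈ interior QubitControl.blochBall,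
      r₁ ∈ QubitControl.blochReachableSet ω γ κ₁ κ₂ r₀) ∧
    (∀ ρ₀ ρ₁ : Matrix (Fin 2) (Fin 2) ℂ,
      QubitControl.IsDensityMatrix ρ₀ → ¬ QubitControl.IsPureState ρ₀ →
      QubitControl.IsDensityMatrix ρ₁ → ¬ QubitControl.IsPureState ρ₁ →
      ρ₁ ∈ QubitControl.masterReachableSet ω γ κ₁ κ₂ ρ₀) := by
  refine ⟨fun r₀ h₀ r₁ h₁ => ?_, fun ρ₀ ρ₁ h₀ hp₀ h₁ hp₁ => ?_⟩
  · rw [QubitControl.blochBall, interior_closedBall _ one_ne_zero, mem_ball_zero_iff] at h₀ h₁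
    exact QubitControl.mem_blochReachableSet_of_norm_lt_one hω.ne' hγ hκ₁.ne' hκ₂.ne' h₀ h₁
  · obtain ⟨r₀, hr₀, rfl⟩ := QubitControl.exists_eq_blochMatrix h₀ hp₀
    obtain ⟨r₁, hr₁, rfl⟩ := QubitControl.exists_eq_blochMatrix h₁ hp₁
    exact QubitControl.blochMatrix_mem_masterReachableSet hω.ne'
      (QubitControl.mem_blochReachableSet_of_norm_lt_one (by positivity) hγ hκ₁.ne' hκ₂.ne'
        hr₀ hr₁)
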